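/- Let $\mathcal H$ and $\mathcal G$ be real Hilbert spaces. For a function $f\colon\mathcal H\to[-\infty,+\infty]$ let $f^*(u)=\sup_{z\in\mathcal H}(\langle z,u\rangle-f(z))$ be its Legendre conjugate, let $f^{**}=(f^*)^*$, and for $\gamma\in(0,+\infty)$ let ${}^{\gamma}f(x)=\inf_{y\in\mathcal H}\bigl(f(y)+\tfrac1{2\gamma}\|x-y\|^2\bigr)$ be its Moreau envelope of index $\gamma$; the same notation is used on $\mathcal G$. For a bounded linear operator $L\colon\mathcal H\to\mathcal G$ with adjoint $L^*$, a function $g\colon\mathcal G\to[-\infty,+\infty]$, and $\gamma\in(0,+\infty)$, the proximal composition and the proximal cocomposition of $g$ and $L$ with parameter $\gamma$ are the functions from $\mathcal H$ to $[-\infty,+\infty]$ $$L\triangleright_\gamma g=\bigl({}^{1/\gamma}(g^*)\circ L\bigr)^*-\tfrac1{2\gamma}\|\cdot\|^2,\qquad L\triangleright^{\gamma}g=\bigl(L\triangleright_{1/\gamma}g^*\bigr)^*,$$ and the infimal postcomposition of $g$ by $L^*$ is $(L^*\triangleright g)(x)=\inf\{g(y): y\in\mathcal G,\ L^*y=x\}$,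 with $\inf\varnothing=+\infty$. **Theorem.** Suppose that $0<\|L\|\le1$, let $g\colon\mathcal G\to(-\infty,+\infty]$ be proper (that is, not identically $+\infty$) and minorized by a continuous affine function $\mathcal G\to\mathbb R$, and let $x\in\mathcal H$. Then the following hold, the limits being taken in $[-\infty,+\infty]$: 1. The function $\gamma\mapsto(L\triangleright_\gamma g)(x)$ from $(0,+\infty)$ to $(-\infty,+\infty]$ is decreasing (in the wide sense). 2. The function $\gamma\mapsto(L\triangleright^{\gamma} g)(x)$ from $(0,+\infty)$ to $(-\infty,+\infty]$ is decreasing (in the wide sense). 3. $\lim_{\gamma\to+\infty}(L\triangleright_\gamma g)(x)=(L^*\triangleright g^{**})(x)$. 4. $\lim_{0<\gamma\to0}(L\triangleright^{\gamma}g)(x)=g^{**}(Lx)$. 5. If $\|L\|<1$, then $\lim_{\gamma\to+\infty}(L\triangleright^{\gamma}g)(x)=\inf_{y\in\mathcal G}g^{**}(y)$. 6. If $\|L\|=1$ and $V=\operatorname{ran}(\mathrm{Id}_{\mathcal G}-L\circ L^*)$ is closed, then $\lim_{\gamma\to+\infty}(L\triangleright^{\gamma}g)(x)=\inf_{y\in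 Lx-V}g^{**}(y)$. -/

import Mathlib

open Filter Topology

noncomputable section

namespace ProxComp

variable {H G : Type*} [NormedAddCommGroup H] [InnerProductSpace ℝ H]
  [NormedAddCommGroup G] [InnerProductSpace ℝ G]

/-- The quadratic kernel `x ↦ ‖x‖² / 2`. -/
def quad (x : H) : ℝ := ‖x‖ ^ 2 / 2

/-- The Legendre conjugate `f*(u) = sup_x (⟨x, u⟩ - f x)` of an extended-real-valued function.
The first term is a real number, so no ambiguous difference `∞ - ∞` occurs. -/
def conj (f : H → EReal) : H → EReal :=
  fun u => ⨆ x : H, ((inner ℝ x u : ℝ) : EReal) - f x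

/-- The Legendre biconjugate `f**`. -/
def biconj (f : H → EReal) : H → EReal := conj (conj f)

/-- The Moreau envelope of index `γ`: `x ↦ inf_y (f y + (1 / γ) ‖x - y‖² / 2)`. -/
def moreauEnv (f : H → EReal) (γ : ℝ) : H → EReal :=
  fun x => ⨅ y : H, f y + ((1 / γ * quad (x - y) : ℝ) : EReal)

/-- The infimal postcomposition of `f` by `M`: `y ↦ inf {f x | M x = y}`, with `inf ∅ = +∞`. -/
def infPostcomp (M : H →L[ℝ] G) (f : H → EReal) : G → EReal :=
  fun y => ⨅ (x : H) (_ : M x = y), f x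

/-- The proximal composition `(moreauEnv g* (1 / γ) ∘ L)* - (1 / γ) ‖·‖² / 2`. -/
def proxComp (L : H →L[ℝ] G) (g : G → EReal) (γ : ℝ) : H → EReal :=
  fun x => conj (fun z : H => moreauEnv (conj g) (1 / γ) (L z)) x
    - ((1 / γ * quad x : ℝ) : EReal)

/-- The proximal cocomposition: the conjugate of the proximal composition of `g*` and `L` with
parameter `1 / γ`. -/
def proxCocomp (L : H →L[ℝ] G) (g : G → EReal) (γ : ℝ) : H → EReal :=
  conj (proxComp L (conj g) (1 / γ))

/-- A function is proper if it is not identically `+∞` and nowhere `-∞`. -/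
def IsProper (f : H → EReal) : Prop :=
  (∃ x, f x < ⊤) ∧ ∀ x, f x ≠ ⊥

/-- The existence of a (real-valued) continuous affine minorant. -/
def HasContinuousAffineMinorant (f : H → EReal) : Prop :=
  ∃ h : H →ᴬ[ℝ] ℝ, ∀ x, ((h x : ℝ) : EReal) ≤ f x

end ProxComp

end

/-! Write `D = Id - L L*` and `q y = ⟨D y, y⟩ / 2 = quad y - quad (L* y)`, which is nonnegative
because `‖L‖ ≤ 1`. Both constructions reduce to penalties by `q`. The composition at `x` is the
minimum of `g** y + q y / γ` over `L* y = x` (`proxComp_le_coe_iff`), and the cocomposition at `x`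
is the supremum of `⟨y, L x⟩ - g* y - γ q y` (`proxCocomp_le_coe_iff`). Monotonicity in `γ` is then
visible, so each limit is an infimum or a supremum over `γ`; when the penalty fades, only the
unpenalized expression remains. For the cocomposition as `γ → ∞`, duality replaces `γ q` by its
conjugate: `q p / γ` at `D p`, and `+∞` off the range of `D` if that range is closed. This is
`isGLB_proxCocomp`. If `‖L‖ < 1`, then `D` is invertible and the range is all of `G`. Both dualities
come from `exists_affine_between`, whose concave function is finite and continuous, so no constraint
qualification is needed. -/

namespace ProxComp

/-! ### Separation by a continuous affine function -/

section Sandwich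

/-- A continuous concave function lying below a convex set of `E × ℝ` is separated from it by a
continuous affine function. -/
theorem exists_affine_between {E : Type*} [NormedAddCommGroup E] [NormedSpace ℝ E] {φ : E → ℝ}
    (hφ : ConcaveOn ℝ Set.univ φ) (hc : Continuous φ) {T : Set (E × ℝ)} (hT : Convex ℝ T)
    (hne : T.Nonempty) (hle : ∀ p ∈ T, φ p.1 ≤ p.2) :
    ∃ (ℓ : E →L[ℝ] ℝ) (c : ℝ), (∀ y, φ y ≤ ℓ y - c) ∧ ∀ p ∈ T, ℓ p.1 - c ≤ p.2 := by
  have hS : Convex ℝ {p : E × ℝ | p.2 < φ p.1} := by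
    simpa using hφ.convex_strict_hypograph
  have hSo : IsOpen {p : E × ℝ | p.2 < φ p.1} :=
    isOpen_lt continuous_snd (hc.comp continuous_fst)
  have hd : Disjoint {p : E × ℝ | p.2 < φ p.1} T :=
    Set.disjoint_left.2 fun p hp hpT => (hle p hpT).not_gt hp
  obtain ⟨f, u, hfS, hfT⟩ := geometric_hahn_banach_open hS hSo hT hd
  have hsplit : ∀ (y : E) (t : ℝ), f (y, t) = f (y, 0) + f (0, 1) * t := by
    intro y t
    have : ((y, t) : E × ℝ) = (y, 0) + t • (0, 1) := by ext <;> simp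
    rw [this, map_add, map_smul, smul_eq_mul, mul_comm]
  obtain ⟨⟨y₀, t₀⟩, h₀⟩ := hne
  -- The hyperplane is not vertical: over `y₀` it separates a point below the graph of `φ` from a
  -- point of `T` above it.
  have hs : 0 < f (0, 1) := by
    have h1 := hfS (y₀, φ y₀ - 1) (by simp)
    have h2 := hfT _ h₀
    have h3 := hle _ h₀
    rw [hsplit] at h1 h2
    simp only at h3
    by_contra h
    nlinarith
  refine ⟨-((f (0, 1))⁻¹ • f.comp (ContinuousLinearMap.inl ℝ E ℝ)), -(u / f (0, 1)),
    fun y => ?_, fun p hp => ?_⟩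
  · refine le_of_forall_lt fun t ht => ?_
    have h1 := hfS (y, t) ht
    rw [hsplit] at h1
    simp only [neg_apply, FunLike.coe_smul,
      ContinuousLinearMap.coe_comp, Pi.smul_apply, Function.comp_apply,
      ContinuousLinearMap.inl_apply, smul_eq_mul]
    have h2 : t < (u - f (y, 0)) / f (0, 1) := by rw [lt_div_iff₀ hs]; linarith
    calc t < _ := h2
      _ = _ := by field_simp; ring
  · have h1 := hfT p hp
    rw [← Prod.mk.eta (p := p), hsplit] at h1
    simp only [neg_apply, FunLike.coe_smul,
      ContinuousLinearMap.coe_comp, Pi.smul_apply, Function.comp_apply,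
      ContinuousLinearMap.inl_apply, smul_eq_mul]
    have h2 : (u - f (p.1, 0)) / f (0, 1) ≤ p.2 := by rw [div_le_iff₀ hs]; linarith
    calc _ = _ := by field_simp; ring
      _ ≤ _ := h2

end Sandwich

/-! ### Monotone limits and extended-real arithmetic -/

section Limits

theorem tendsto_atTop_of_antitoneOn_Ioi {f : ℝ → EReal} {a : EReal}
    (hf : AntitoneOn f (Set.Ioi 0)) (ha : IsGLB (f '' Set.Ioi 0) a) :
    Tendsto f atTop (𝓝 a) := by
  refine tendsto_order.2 ⟨fun b hb => ?_, fun b hb => ?_⟩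
  · filter_upwards [eventually_gt_atTop 0] with γ hγ
    exact hb.trans_le (ha.1 ⟨γ, hγ, rfl⟩)
  · obtain ⟨_, ⟨γ₀, h₀, rfl⟩, h⟩ := (isGLB_lt_iff ha).1 hb
    filter_upwards [eventually_ge_atTop γ₀] with γ hγ
    exact (hf h₀ (lt_of_lt_of_le h₀ hγ) hγ).trans_lt h

theorem tendsto_nhdsGT_of_antitoneOn_Ioi {f : ℝ → EReal} {a : EReal}
    (hf : AntitoneOn f (Set.Ioi 0)) (ha : IsLUB (f '' Set.Ioi 0) a) :
    Tendsto f (𝓝[>] 0) (𝓝 a) := by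
  refine tendsto_order.2 ⟨fun b hb => ?_, fun b hb => ?_⟩
  · obtain ⟨_, ⟨γ₀, h₀, rfl⟩, h⟩ := (lt_isLUB_iff ha).1 hb
    filter_upwards [Ioc_mem_nhdsGT h₀] with γ hγ
    exact h.trans_le (hf hγ.1 h₀ hγ.2)
  · filter_upwards [self_mem_nhdsWithin] with γ hγ
    exact (ha.1 ⟨γ, hγ, rfl⟩).trans_lt hb

theorem le_of_forall_le_add_inv_mul {a b : EReal} {K : ℝ}
    (h : ∀ γ : ℝ, 0 < γ → b ≤ a + ((1 / γ * K : ℝ) : EReal)) : b ≤ a := by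
  have h1 : Tendsto (fun γ : ℝ => 1 / γ * K) atTop (𝓝 0) := by
    simpa using (tendsto_inv_atTop_zero (𝕜 := ℝ)).mul_const K
  have h2 : Tendsto (fun γ : ℝ => a + ((1 / γ * K : ℝ) : EReal)) atTop (𝓝 (a + ((0 : ℝ) : EReal))) :=
    Tendsto.comp (f := fun γ : ℝ => (a, ((1 / γ * K : ℝ) : EReal)))
      (EReal.continuousAt_add (p := (a, ((0 : ℝ) : EReal))) (by simp) (by simp))
      (tendsto_const_nhds.prodMk_nhds ((continuous_coe_real_ereal.tendsto 0).comp h1))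
  rw [EReal.coe_zero, add_zero] at h2
  refine ge_of_tendsto h2 ?_
  filter_upwards [eventually_gt_atTop 0] with γ hγ using h γ hγ

/-- Testing against real upper bounds keeps the later arguments free of infinite values. -/
theorem le_of_forall_real_le {a b : EReal} (h : ∀ c : ℝ, b ≤ c → a ≤ c) : a ≤ b := by
  refine EReal.le_of_forall_lt_iff_le.1 fun c hc => h c hc.le

theorem coe_sub_le_coe_iff {a c : ℝ} {b : EReal} :
    (a : EReal) - b ≤ c ↔ ((a - c : ℝ) : EReal) ≤ b := by
  induction b with
  | bot => simp [-EReal.coe_sub]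
  | top => simp [-EReal.coe_sub]
  | coe b => norm_cast; constructor <;> intro h <;> linarith

theorem add_coe_le_coe_iff {a c : ℝ} {b : EReal} :
    b + (a : EReal) ≤ c ↔ b ≤ ((c - a : ℝ) : EReal) := by
  induction b with
  | bot => simp [-EReal.coe_sub]
  | top => rw [EReal.top_add_coe]; simp [-EReal.coe_sub, -EReal.coe_add]
  | coe b => norm_cast; constructor <;> intro h <;> linarith

theorem coe_le_add_coe_iff {a c : ℝ} {b : EReal} :
    (c : EReal) ≤ b + (a : EReal) ↔ ((c - a : ℝ) : EReal) ≤ b := by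
  induction b with
  | bot => simp [-EReal.coe_sub]
  | top => rw [EReal.top_add_coe]; simp [-EReal.coe_sub, -EReal.coe_add]
  | coe b => norm_cast; constructor <;> intro h <;> linarith

theorem sub_coe_le_coe_iff {a c : ℝ} {b : EReal} :
    b - (a : EReal) ≤ c ↔ b ≤ ((c + a : ℝ) : EReal) := by
  induction b with
  | bot => simp [-EReal.coe_sub]
  | top => rw [EReal.top_sub_coe]; simp [-EReal.coe_sub, -EReal.coe_add]
  | coe b => norm_cast; constructor <;> intro h <;> linarith

end Limits

/-! ### Conjugates and biconjugates -/

section Conjugate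

variable {H G : Type*} [NormedAddCommGroup H] [InnerProductSpace ℝ H]
  [NormedAddCommGroup G] [InnerProductSpace ℝ G]

theorem conj_le_coe_iff {f : H → EReal} {u : H} {c : ℝ} :
    conj f u ≤ c ↔ ∀ z, ((inner ℝ z u - c : ℝ) : EReal) ≤ f z := by
  simp only [conj, iSup_le_iff, coe_sub_le_coe_iff]

theorem conj_antitone {f f' : H → EReal} (h : ∀ z, f z ≤ f' z) (u : H) :
    conj f' u ≤ conj f u :=
  iSup_mono fun z => EReal.sub_le_sub le_rfl (h z)

theorem conj_ne_bot {f : H → EReal} (h : ∃ z, f z < ⊤) (u : H) : conj f u ≠ ⊥ := by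
  obtain ⟨z, hz⟩ := h
  intro hb
  have h1 : ((inner ℝ z u : ℝ) : EReal) - f z ≤ ⊥ :=
    (le_iSup (fun z : H => ((inner ℝ z u : ℝ) : EReal) - f z) z).trans hb.le
  induction hfz : f z with
  | bot => simp [hfz] at h1
  | top => simp [hfz] at hz
  | coe r => rw [hfz, ← EReal.coe_sub] at h1; simp [-EReal.coe_sub] at h1

theorem biconj_le (f : H → EReal) (x : H) : biconj f x ≤ f x := by
  refine le_of_forall_real_le fun c hc => conj_le_coe_iff.2 fun u => ?_
  refine EReal.le_of_forall_lt_iff_le.1 fun r hr => ?_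
  have h1 := (conj_le_coe_iff.1 hr.le x).trans hc
  rw [EReal.coe_le_coe_iff] at h1 ⊢
  rw [real_inner_comm]
  linarith

theorem exists_biconj_lt_top {g : G → EReal} (hg : ∃ x, g x < ⊤) : ∃ y, biconj g y < ⊤ :=
  hg.imp fun y hy => (biconj_le g y).trans_lt hy

theorem conj_biconj (f : H → EReal) : biconj (conj f) = conj f := by
  funext u
  refine le_antisymm (biconj_le _ _) ?_
  exact conj_antitone (biconj_le f) u

theorem exists_conj_lt_top [CompleteSpace G] {g : G → EReal}
    (h : HasContinuousAffineMinorant g) : ∃ u, conj g u < ⊤ := by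
  obtain ⟨a, ha⟩ := h
  -- The conjugate is finite at the slope of an affine minorant.
  refine ⟨(InnerProductSpace.toDual ℝ G).symm a.contLinear, ?_⟩
  refine lt_of_le_of_lt (conj_le_coe_iff (c := -a 0).2 fun z => ?_) (EReal.coe_lt_top _)
  refine le_trans ?_ (ha z)
  rw [EReal.coe_le_coe_iff, real_inner_comm, InnerProductSpace.toDual_symm_apply]
  have h1 : a z = a.contLinear z + a 0 := congrFun a.decomp z
  linarith

theorem convex_conj_epigraph (f : H → EReal) :
    Convex ℝ {p : H × ℝ | conj f p.1 ≤ (p.2 : EReal)} := by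
  have : {p : H × ℝ | conj f p.1 ≤ (p.2 : EReal)} =
      ⋂ z, {p : H × ℝ | ((inner ℝ z p.1 - p.2 : ℝ) : EReal) ≤ f z} := by
    ext p; simp [conj_le_coe_iff]
  rw [this]
  refine convex_iInter fun z => ?_
  induction f z with
  | bot => simp [-EReal.coe_sub, convex_empty]
  | top => simp [-EReal.coe_sub, convex_univ]
  | coe r =>
    simp only [EReal.coe_le_coe_iff]
    exact convex_halfSpace_le (IsLinearMap.mk
      (fun p q => by simp [inner_add_right]; ring)
      (fun c p => by simp [inner_smul_right]; ring)) r

theorem proxComp_le_coe_iff_forall {L : H →L[ℝ] G} {g : G → EReal} {γ : ℝ} {x : H} {c : ℝ} :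
    proxComp L g γ x ≤ c ↔ ∀ (z : H) (u : G),
      ((inner ℝ z x - (c + 1 / γ * quad x) - γ * quad (L z - u) : ℝ) : EReal) ≤ conj g u := by
  simp only [proxComp, sub_coe_le_coe_iff, conj_le_coe_iff, moreauEnv, le_iInf_iff,
    coe_le_add_coe_iff, one_div_one_div]

theorem proxComp_ne_bot {L : H →L[ℝ] G} {g : G → EReal} (hg : ∃ u, conj g u < ⊤)
    (γ : ℝ) (x : H) : proxComp L g γ x ≠ ⊥ := by
  obtain ⟨u, hu⟩ := hg
  obtain ⟨t, ht, -⟩ := EReal.lt_iff_exists_real_btwn.1 hu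
  intro hb
  -- The constant makes the inequality at `z = 0` read `t + 1 ≤ conj g u`.
  have h1 := proxComp_le_coe_iff_forall.1
    (hb.le.trans (bot_le (a := ((-1 / γ * quad x - γ * quad (L 0 - u) - t - 1 : ℝ) : EReal)))) 0 u
  have h2 := EReal.coe_le_coe_iff.1 (h1.trans ht.le)
  rw [inner_zero_left, neg_div, neg_mul] at h2
  linarith

end Conjugate

/-! ### The quadratic kernel -/

section Quad

section

variable {E : Type*} [NormedAddCommGroup E]

theorem quad_nonneg (x : E) : 0 ≤ quad x := by
  unfold quad; positivity

theorem quad_zero : quad (0 : E) = 0 := by simp [quad]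

end


variable {H : Type*} [NormedAddCommGroup H] [InnerProductSpace ℝ H]

theorem inner_self_eq_two_mul_quad (x : H) : inner ℝ x x = 2 * quad x := by
  rw [real_inner_self_eq_norm_sq, quad]; ring

theorem quad_smul (r : ℝ) (x : H) : quad (r • x) = r ^ 2 * quad x := by
  simp [quad, norm_smul, mul_pow]; ring

theorem quad_convex_combination {a b : ℝ} (hab : a + b = 1) (p q : H) :
    quad (a • p + b • q) = a * quad p + b * quad q - a * b * quad (p - q) := by
  obtain rfl : b = 1 - a := by linarith
  rw [quad, quad, quad, quad, norm_add_sq_real, norm_sub_sq_real, norm_smul, norm_smul,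
    real_inner_smul_left, real_inner_smul_right, mul_pow, mul_pow, Real.norm_eq_abs,
    Real.norm_eq_abs, sq_abs, sq_abs]
  ring

theorem convexOn_quad : ConvexOn ℝ Set.univ (quad : H → ℝ) := by
  refine ⟨convex_univ, fun p _ q _ a b ha hb hab => ?_⟩
  rw [quad_convex_combination hab, smul_eq_mul, smul_eq_mul]
  exact sub_le_self _ (mul_nonneg (mul_nonneg ha hb) (quad_nonneg _))

theorem inner_le_mul_quad_add {γ : ℝ} (hγ : 0 < γ) (v y : H) :
    inner ℝ v y ≤ γ * quad v + 1 / γ * quad y := by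
  have h1 := real_inner_le_norm v y
  have h2 : γ * quad v + 1 / γ * quad y - ‖v‖ * ‖y‖ = (γ * ‖v‖ - ‖y‖) ^ 2 / (2 * γ) := by
    simp only [quad]; field_simp; ring
  have h3 : 0 ≤ (γ * ‖v‖ - ‖y‖) ^ 2 / (2 * γ) := by positivity
  linarith

theorem eq_zero_of_forall_mul_le {a b : ℝ} (h : ∀ r : ℝ, r * a ≤ b) : a = 0 := by
  by_contra ha
  have := h ((b + 1) / a)
  rw [div_mul_cancel₀ _ ha] at this
  linarith

theorem eq_zero_of_forall_inner_le {w : H} {b : ℝ} (h : ∀ z, inner ℝ z w ≤ b) : w = 0 := by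
  refine inner_self_eq_zero (𝕜 := ℝ).1 (eq_zero_of_forall_mul_le (b := b) fun r => ?_)
  simpa [inner_smul_left] using h (r • w)

end Quad

/-! ### The proximal composition -/

section Composition

variable {H G : Type*} [NormedAddCommGroup H] [InnerProductSpace ℝ H] [CompleteSpace H]
  [NormedAddCommGroup G] [InnerProductSpace ℝ G] [CompleteSpace G]

theorem quad_adjoint_le {L : H →L[ℝ] G} (hL : ‖L‖ ≤ 1) (y : G) :
    quad (ContinuousLinearMap.adjoint L y) ≤ quad y := by
  have h1 : ‖ContinuousLinearMap.adjoint L y‖ ≤ ‖y‖ := by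
    refine ((ContinuousLinearMap.adjoint L).le_opNorm y).trans ?_
    rw [LinearIsometryEquiv.norm_map]
    exact mul_le_of_le_one_left (norm_nonneg y) hL
  unfold quad
  gcongr

/-- The proximal composition is the exact infimal postcomposition
`min {g** y + (1 / γ) (‖y‖² - ‖x‖²) / 2 | L* y = x}`. -/
theorem proxComp_le_coe_iff {L : H →L[ℝ] G} {g : G → EReal} (hg : ∃ u, conj g u < ⊤)
    {γ : ℝ} (hγ : 0 < γ) {x : H} {c : ℝ} :
    proxComp L g γ x ≤ c ↔ ∃ y, ContinuousLinearMap.adjoint L y = x ∧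
      biconj g y + ((1 / γ * (quad y - quad x) : ℝ) : EReal) ≤ c := by
  rw [proxComp_le_coe_iff_forall]
  constructor
  · intro h
    set c' : ℝ := c + 1 / γ * quad x with hc'
    have hφ : ConcaveOn ℝ Set.univ
        (fun p : G × H => inner ℝ p.2 x - c' - γ * quad (L p.2 - p.1)) := by
      have h1 : ConcaveOn ℝ Set.univ (fun p : G × H => (inner ℝ x p.2 : ℝ)) :=
        (((innerSL ℝ x).comp (ContinuousLinearMap.snd ℝ G H)).toLinearMap).concaveOn convex_univ
      have h2 : ConvexOn ℝ Set.univ (fun p : G × H => γ * quad (L p.2 - p.1)) := by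
        have := ((convexOn_quad (H := G)).comp_linearMap
          (L.comp (ContinuousLinearMap.snd ℝ G H) -
            ContinuousLinearMap.fst ℝ G H).toLinearMap).smul hγ.le
        simpa using this
      have h3 := (h1.add_const (-c')).sub h2
      have h4 : (fun p : G × H => inner ℝ p.2 x - c' - γ * quad (L p.2 - p.1)) =
          ((fun p : G × H => (inner ℝ x p.2 : ℝ)) + fun _ => -c') -
            fun p => γ * quad (L p.2 - p.1) := by
        funext p
        simp only [Pi.sub_apply, Pi.add_apply, real_inner_comm x]
        ring
      rw [h4]
      exact h3
    have hcont : Continuous (fun p : G × H => inner ℝ p.2 x - c' - γ * quad (L p.2 - p.1)) := by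
      unfold quad; fun_prop
    obtain ⟨u₀, hu₀⟩ := hg
    obtain ⟨t₀, ht₀, -⟩ := EReal.lt_iff_exists_real_btwn.1 hu₀
    -- The epigraph of `conj g` is extended to be constant in `z`, which forces `ℓ` to vanish in
    -- that direction.
    obtain ⟨ℓ, d, hℓφ, hℓT⟩ := exists_affine_between hφ hcont
      (T := {p : (G × H) × ℝ | conj g p.1.1 ≤ (p.2 : EReal)})
      ((convex_conj_epigraph g).linear_preimage
        ((LinearMap.fst ℝ G H).prodMap (LinearMap.id : ℝ →ₗ[ℝ] ℝ)))
      ⟨((u₀, 0), t₀), ht₀.le⟩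
      (fun p hp => EReal.coe_le_coe_iff.1 ((h p.1.2 p.1.1).trans hp))
    have hsplit : ∀ (u : G) (z : H), ℓ (u, z) = ℓ (u, 0) + ℓ (0, z) := by
      intro u z
      rw [← map_add]; simp
    have hz : ∀ z : H, ℓ (0, z) = 0 := by
      intro z
      refine eq_zero_of_forall_mul_le (b := t₀ + d - ℓ (u₀, 0)) fun r => ?_
      have h1 := hℓT ((u₀, r • z), t₀) ht₀.le
      rw [hsplit] at h1
      have h2 : ℓ (0, r • z) = r * ℓ (0, z) := by
        rw [← smul_eq_mul, ← map_smul]; simp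
      simp only [h2] at h1
      linarith
    set y : G := (InnerProductSpace.toDual ℝ G).symm
      (ℓ.comp (ContinuousLinearMap.inl ℝ G H)) with hy
    have hyu : ∀ (u : G) (z : H), ℓ (u, z) = inner ℝ u y := by
      intro u z
      rw [real_inner_comm, hy, InnerProductSpace.toDual_symm_apply, hsplit, hz]
      simp
    simp only [hyu] at hℓφ hℓT
    have hbi : biconj g y ≤ (d : EReal) := by
      refine conj_le_coe_iff.2 fun u => le_of_forall_real_le fun t ht => ?_
      exact EReal.coe_le_coe_iff.2 (hℓT ((u, 0), t) ht)
    have hx : x - ContinuousLinearMap.adjoint L y = 0 := by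
      -- On the graph `u = L z` the quadratic term vanishes, leaving a linear form in `z` that is
      -- bounded above.
      refine eq_zero_of_forall_inner_le (b := c' - d) fun z => ?_
      have h1 := hℓφ (L z, z)
      simp only [sub_self, quad_zero] at h1
      rw [inner_sub_right, ContinuousLinearMap.adjoint_inner_right]
      linarith
    refine ⟨y, (sub_eq_zero.1 hx).symm, ?_⟩
    rw [add_coe_le_coe_iff]
    refine hbi.trans (EReal.coe_le_coe_iff.2 ?_)
    -- This point maximizes `-γ * quad u - ⟨u, y⟩`, hence gives the sharpest bound on `d`.
    have h1 := hℓφ (-((1 / γ) • y), 0)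
    simp only [map_zero, zero_sub, neg_neg, quad_smul, inner_zero_left, inner_neg_left,
      inner_smul_left, inner_self_eq_two_mul_quad] at h1
    have h2 : γ * ((1 / γ) ^ 2 * quad y) = 1 / γ * quad y := by field_simp
    simp only [h2, conj_trivial] at h1
    linarith
  · rintro ⟨y, rfl, hy⟩ z u
    rw [add_coe_le_coe_iff] at hy
    refine le_trans ?_ (conj_le_coe_iff.1 hy u)
    rw [EReal.coe_le_coe_iff, ContinuousLinearMap.adjoint_inner_right]
    have h1 := inner_le_mul_quad_add hγ (L z - u) y
    rw [inner_sub_left] at h1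
    linarith

theorem proxComp_adjoint_le {L : H →L[ℝ] G} {g : G → EReal} (hg : ∃ u, conj g u < ⊤)
    {γ : ℝ} (hγ : 0 < γ) (y : G) :
    proxComp L g γ (ContinuousLinearMap.adjoint L y) ≤ biconj g y +
      ((1 / γ * (quad y - quad (ContinuousLinearMap.adjoint L y)) : ℝ) : EReal) :=
  le_of_forall_real_le fun _ hc => (proxComp_le_coe_iff hg hγ).2 ⟨y, rfl, hc⟩

theorem proxComp_antitoneOn {L : H →L[ℝ] G} (hL : ‖L‖ ≤ 1) {g : G → EReal}
    (hg : ∃ u, conj g u < ⊤) (x : H) :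
    AntitoneOn (fun γ : ℝ => proxComp L g γ x) (Set.Ioi 0) := by
  intro γ hγ δ hδ hγδ
  refine le_of_forall_real_le fun c hc => ?_
  obtain ⟨y, rfl, hy⟩ := (proxComp_le_coe_iff hg hγ).1 hc
  refine (proxComp_le_coe_iff hg hδ).2 ⟨y, rfl, le_trans ?_ hy⟩
  refine add_le_add le_rfl (EReal.coe_le_coe_iff.2 ?_)
  exact mul_le_mul_of_nonneg_right (one_div_le_one_div_of_le hγ hγδ)
    (sub_nonneg.2 (quad_adjoint_le hL y))

theorem isGLB_proxComp {L : H →L[ℝ] G} (hL : ‖L‖ ≤ 1) {g : G → EReal}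
    (hg : ∃ u, conj g u < ⊤) (x : H) :
    IsGLB ((fun γ : ℝ => proxComp L g γ x) '' Set.Ioi 0)
      (infPostcomp (ContinuousLinearMap.adjoint L) (biconj g) x) := by
  constructor
  · rintro _ ⟨γ, hγ, rfl⟩
    refine le_of_forall_real_le fun c hc => ?_
    obtain ⟨y, hyx, hy⟩ := (proxComp_le_coe_iff hg hγ).1 hc
    refine (iInf₂_le y hyx).trans (le_trans ?_ hy)
    subst hyx
    refine le_add_of_nonneg_right (EReal.coe_nonneg.2 ?_)
    exact mul_nonneg (one_div_nonneg.2 (le_of_lt hγ)) (sub_nonneg.2 (quad_adjoint_le hL y))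
  · intro b hb
    refine le_iInf₂ fun y hyx => ?_
    subst hyx
    exact le_of_forall_le_add_inv_mul fun γ hγ =>
      (hb ⟨γ, hγ, rfl⟩).trans (proxComp_adjoint_le hg hγ y)

end Composition

/-! ### The proximal cocomposition -/

section Cocomposition

variable {H G : Type*} [NormedAddCommGroup H] [InnerProductSpace ℝ H] [CompleteSpace H]
  [NormedAddCommGroup G] [InnerProductSpace ℝ G] [CompleteSpace G]

/-- Conjugating an infimum over the fibres `L* y = u` merges the suprema over `u` and `y` into one
over `y`. -/
theorem proxCocomp_le_coe_iff {L : H →L[ℝ] G} {g : G → EReal} (hg : ∃ x, g x < ⊤)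
    {γ : ℝ} (hγ : 0 < γ) {x : H} {c : ℝ} :
    proxCocomp L g γ x ≤ c ↔ ∀ y, ((inner ℝ y (L x) - c -
      γ * (quad y - quad (ContinuousLinearMap.adjoint L y)) : ℝ) : EReal) ≤ conj g y := by
  have hg' : ∃ u, conj (conj g) u < ⊤ := exists_biconj_lt_top hg
  have hγ' : 0 < 1 / γ := one_div_pos.2 hγ
  rw [proxCocomp, conj_le_coe_iff]
  constructor
  · intro h y
    have h1 := (h (ContinuousLinearMap.adjoint L y)).trans (proxComp_adjoint_le hg' hγ' y)
    rwa [conj_biconj, one_div_one_div, coe_le_add_coe_iff,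
      ContinuousLinearMap.adjoint_inner_left] at h1
  · intro h u
    refine le_of_forall_real_le fun d hd => ?_
    obtain ⟨y, rfl, hy⟩ := (proxComp_le_coe_iff hg' hγ').1 hd
    rw [conj_biconj, one_div_one_div, add_coe_le_coe_iff] at hy
    have h1 := EReal.coe_le_coe_iff.1 ((h y).trans hy)
    rw [EReal.coe_le_coe_iff, ContinuousLinearMap.adjoint_inner_left]
    linarith

theorem proxCocomp_ne_bot {L : H →L[ℝ] G} {g : G → EReal} (hg : ∃ x, g x < ⊤)
    (hg' : ∃ u, conj g u < ⊤) {γ : ℝ} (hγ : 0 < γ) (x : H) : proxCocomp L g γ x ≠ ⊥ := by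
  obtain ⟨u, hu⟩ := hg'
  refine conj_ne_bot ⟨ContinuousLinearMap.adjoint L u, ?_⟩ x
  refine (proxComp_adjoint_le (exists_biconj_lt_top hg) (one_div_pos.2 hγ) u).trans_lt ?_
  rw [conj_biconj]
  exact EReal.add_lt_top hu.ne (EReal.coe_ne_top _)

theorem proxCocomp_antitoneOn {L : H →L[ℝ] G} (hL : ‖L‖ ≤ 1) {g : G → EReal}
    (hg : ∃ x, g x < ⊤) (x : H) :
    AntitoneOn (fun γ : ℝ => proxCocomp L g γ x) (Set.Ioi 0) := fun _ hγ _ hδ hγδ =>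
  conj_antitone (fun z => proxComp_antitoneOn hL (exists_biconj_lt_top hg) z
    (Set.mem_Ioi.2 (one_div_pos.2 hδ)) (Set.mem_Ioi.2 (one_div_pos.2 hγ)) (one_div_le_one_div_of_le hγ hγδ)) x

theorem isLUB_proxCocomp {L : H →L[ℝ] G} (hL : ‖L‖ ≤ 1) {g : G → EReal}
    (hg : ∃ x, g x < ⊤) (x : H) :
    IsLUB ((fun γ : ℝ => proxCocomp L g γ x) '' Set.Ioi 0) (biconj g (L x)) := by
  constructor
  · rintro _ ⟨γ, hγ, rfl⟩
    refine le_of_forall_real_le fun c hc => (proxCocomp_le_coe_iff hg hγ).2 fun y => ?_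
    refine le_trans (EReal.coe_le_coe_iff.2 ?_) (conj_le_coe_iff.1 hc y)
    exact sub_le_self _ (mul_nonneg (le_of_lt hγ) (sub_nonneg.2 (quad_adjoint_le hL y)))
  · intro b hb
    refine le_of_forall_real_le fun c hc => conj_le_coe_iff.2 fun y => ?_
    refine le_of_forall_le_add_inv_mul
      (K := quad y - quad (ContinuousLinearMap.adjoint L y)) fun γ hγ => ?_
    rw [coe_le_add_coe_iff]
    exact (proxCocomp_le_coe_iff hg (one_div_pos.2 hγ)).1
      ((hb ⟨1 / γ, one_div_pos.2 hγ, rfl⟩).trans hc) y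

/-- The defect operator `Id - L L*`. -/
noncomputable abbrev defect (L : H →L[ℝ] G) : G →L[ℝ] G :=
  ContinuousLinearMap.id ℝ G - L ∘L ContinuousLinearMap.adjoint L

theorem inner_defect (L : H →L[ℝ] G) (y z : G) :
    inner ℝ (defect L y) z = inner ℝ y z -
      inner ℝ (ContinuousLinearMap.adjoint L y) (ContinuousLinearMap.adjoint L z) := by
  simp [inner_sub_left, ContinuousLinearMap.adjoint_inner_right]

theorem inner_defect_self (L : H →L[ℝ] G) (y : G) :
    inner ℝ (defect L y) y =
      2 * (quad y - quad (ContinuousLinearMap.adjoint L y)) := by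
  rw [inner_defect, inner_self_eq_two_mul_quad, inner_self_eq_two_mul_quad]; ring

theorem inner_defect_comm (L : H →L[ℝ] G) (y z : G) :
    inner ℝ (defect L y) z = inner ℝ y (defect L z) := by
  rw [← real_inner_comm y, inner_defect, inner_defect, real_inner_comm z y]
  congr 1
  exact real_inner_comm _ _

theorem inner_defect_self_nonneg {L : H →L[ℝ] G} (hL : ‖L‖ ≤ 1) (y : G) :
    0 ≤ inner ℝ (defect L y) y := by
  rw [inner_defect_self]
  linarith [quad_adjoint_le hL y]

/-- Young's inequality for the positive operator `Id - L L*`. -/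
theorem inner_defect_le {L : H →L[ℝ] G} (hL : ‖L‖ ≤ 1) {γ : ℝ} (hγ : 0 < γ) (p y : G) :
    inner ℝ y (defect L p) ≤ γ * (quad y - quad (ContinuousLinearMap.adjoint L y)) +
      1 / γ * (quad p - quad (ContinuousLinearMap.adjoint L p)) := by
  -- Expanding this and dividing by `2 * γ` gives the claim.
  have h := inner_defect_self_nonneg hL (p - γ • y)
  have h1 : inner ℝ (defect L p) y = inner ℝ y (defect L p) := real_inner_comm _ _
  rw [map_sub, map_smul, inner_sub_left, inner_sub_right, inner_sub_right, inner_smul_right,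
    inner_smul_right, real_inner_smul_left, real_inner_smul_left, inner_defect_comm L y p,
    inner_defect_self, inner_defect_self, h1] at h
  have h2 : 0 ≤ (1 / γ * (quad p - quad (ContinuousLinearMap.adjoint L p)) +
      γ * (quad y - quad (ContinuousLinearMap.adjoint L y)) - inner ℝ y (defect L p)) * (2 * γ) := by
    have : (1 / γ * (quad p - quad (ContinuousLinearMap.adjoint L p))) * (2 * γ) =
      2 * (quad p - quad (ContinuousLinearMap.adjoint L p)) := by field_simp
    rw [sub_mul, add_mul, this]
    linarith
  have := nonneg_of_mul_nonneg_left h2 (by positivity)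
  linarith

/-- `D` is self-adjoint, so the orthogonal complement of its range lies in its kernel; a closed
range is its own double complement. -/
theorem mem_range_defect {L : H →L[ℝ] G} (hV : IsClosed (Set.range (defect L))) {v : G}
    (hv : ∀ y, defect L y = 0 → inner ℝ y v = 0) : v ∈ Set.range (defect L) := by
  have hc : IsClosed ((defect L).range : Set G) := hV
  have : CompleteSpace (defect L).range := hc.completeSpace_coe
  have h1 : v ∈ (defect L).rangeᗮᗮ := by
    refine (Submodule.mem_orthogonal _ _).2 fun y hy => hv y ?_
    refine inner_self_eq_zero (𝕜 := ℝ).1 ?_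
    rw [inner_defect_comm, real_inner_comm]
    exact (Submodule.mem_orthogonal _ _).1 hy _ ⟨_, rfl⟩
  rw [Submodule.orthogonal_orthogonal] at h1
  exact h1

theorem isGLB_proxCocomp {L : H →L[ℝ] G} (hL : ‖L‖ ≤ 1) {g : G → EReal}
    (hg : ∃ x, g x < ⊤) (hg' : ∃ u, conj g u < ⊤) (hV : IsClosed (Set.range (defect L))) (x : H) :
    IsGLB ((fun γ : ℝ => proxCocomp L g γ x) '' Set.Ioi 0)
      (⨅ y ∈ (fun v : G => L x - v) '' Set.range (defect L), biconj g y) := by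
  constructor
  · rintro _ ⟨γ, hγ : 0 < γ, rfl⟩
    refine le_of_forall_real_le fun c hc => ?_
    rw [proxCocomp_le_coe_iff hg hγ] at hc
    have hφ : ConcaveOn ℝ Set.univ (fun y : G => inner ℝ y (L x) - c -
        γ * (quad y - quad (ContinuousLinearMap.adjoint L y))) := by
      refine ⟨convex_univ, fun p _ q _ a b ha hb hab => ?_⟩
      have h1 := inner_defect_self_nonneg hL (p - q)
      rw [inner_defect_self, map_sub] at h1
      have h2 := mul_nonneg (mul_nonneg hγ.le (mul_nonneg ha hb)) h1
      beta_reduce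
      rw [map_add, map_smul, map_smul, quad_convex_combination hab, quad_convex_combination hab,
        inner_add_left, real_inner_smul_left, real_inner_smul_left, smul_eq_mul, smul_eq_mul]
      have h3 : c = a * c + b * c := by rw [← add_mul, hab, one_mul]
      linarith
    have hcont : Continuous (fun y : G => inner ℝ y (L x) - c -
        γ * (quad y - quad (ContinuousLinearMap.adjoint L y))) := by
      unfold quad; fun_prop
    obtain ⟨u₀, hu₀⟩ := hg'
    obtain ⟨t₀, ht₀, -⟩ := EReal.lt_iff_exists_real_btwn.1 hu₀
    obtain ⟨ℓ, d, hℓφ, hℓT⟩ := exists_affine_between hφ hcont (convex_conj_epigraph g)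
      ⟨(u₀, t₀), ht₀.le⟩ (fun p hp => EReal.coe_le_coe_iff.1 ((hc p.1).trans hp))
    set w : G := (InnerProductSpace.toDual ℝ G).symm ℓ with hw
    have hwu : ∀ u : G, ℓ u = inner ℝ u w := by
      intro u
      rw [real_inner_comm, hw, InnerProductSpace.toDual_symm_apply]
    simp only [hwu] at hℓφ hℓT
    -- The penalty vanishes on the kernel of `D`, so `⟨·, L x - w⟩` is bounded above there, hence
    -- zero.
    have hmem : L x - w ∈ Set.range (defect L) := by
      refine mem_range_defect hV fun y hy => ?_
      refine eq_zero_of_forall_mul_le (b := c - d) fun r => ?_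
      have h1 := hℓφ (r • y)
      have h2 := inner_defect_self L (r • y)
      rw [map_smul, hy, smul_zero, inner_zero_left, eq_comm] at h2
      rw [(mul_eq_zero.1 h2).resolve_left two_ne_zero, real_inner_smul_left,
        real_inner_smul_left] at h1
      rw [inner_sub_right]
      linarith
    refine (iInf₂_le w ⟨_, hmem, sub_sub_cancel _ _⟩).trans ?_
    refine conj_le_coe_iff.2 fun u => le_of_forall_real_le fun t ht => ?_
    have h1 := hℓT (u, t) ht
    have h2 := hℓφ 0
    simp only [map_zero, inner_zero_left, quad_zero] at h1 h2
    rw [EReal.coe_le_coe_iff]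
    linarith
  · rintro b hb
    refine le_iInf₂ ?_
    rintro _ ⟨_, ⟨p, rfl⟩, rfl⟩
    refine le_of_forall_le_add_inv_mul
      (K := quad p - quad (ContinuousLinearMap.adjoint L p)) fun γ hγ => ?_
    refine (hb ⟨γ, hγ, rfl⟩).trans (le_of_forall_real_le fun c hc => ?_)
    rw [add_coe_le_coe_iff] at hc
    refine (proxCocomp_le_coe_iff hg hγ).2 fun y => ?_
    refine le_trans (EReal.coe_le_coe_iff.2 ?_) (conj_le_coe_iff.1 hc y)
    -- Young's inequality bounds the cocomposition by `g** (L x - D p) + q p / γ`, whose last term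
    -- fades.
    have h1 := inner_defect_le hL hγ p y
    have h2 : inner ℝ y (L x - defect L p) = inner ℝ y (L x) - inner ℝ y (defect L p) :=
      inner_sub_right _ _ _
    simp only [h2]
    linarith

/-- Neumann series: `‖L L*‖ ≤ ‖L‖² < 1`. -/
theorem range_defect_eq_univ {L : H →L[ℝ] G} (hL : ‖L‖ < 1) :
    Set.range (defect L) = Set.univ := by
  have h1 : ‖L ∘L ContinuousLinearMap.adjoint L‖ < 1 := by
    refine (ContinuousLinearMap.opNorm_comp_le _ _).trans_lt ?_
    rw [LinearIsometryEquiv.norm_map]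
    nlinarith [norm_nonneg L]
  obtain ⟨e, he⟩ := isUnit_one_sub_of_norm_lt_one h1
  refine Set.eq_univ_of_forall fun v => ⟨(e⁻¹ : (G →L[ℝ] G)ˣ).1 v, ?_⟩
  have h2 : defect L = e.1 := he.symm
  rw [h2, ← mul_apply_eq_comp, Units.mul_inv]
  rfl

end Cocomposition

end ProxComp

theorem mainTheorem3
    {H G : Type*} [NormedAddCommGroup H] [InnerProductSpace ℝ H] [CompleteSpace H]
    [NormedAddCommGroup G] [InnerProductSpace ℝ G] [CompleteSpace G]
    (L : H →L[ℝ] G) (hL0 : 0 < ‖L‖) (hL1 : ‖L‖ ≤ 1)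
    (g : G → EReal) (hg : ProxComp.IsProper g)
    (hcam : ProxComp.HasContinuousAffineMinorant g) (x : H) :
    -- the composition takes values in `(-∞, +∞]` and is decreasing in `γ`
    ((∀ γ : ℝ, 0 < γ → ProxComp.proxComp L g γ x ≠ ⊥) ∧
      AntitoneOn (fun γ : ℝ => ProxComp.proxComp L g γ x) (Set.Ioi 0)) ∧
    -- the cocomposition takes values in `(-∞, +∞]` and is decreasing in `γ`
    ((∀ γ : ℝ, 0 < γ → ProxComp.proxCocomp L g γ x ≠ ⊥) ∧
      AntitoneOn (fun γ : ℝ => ProxComp.proxCocomp L g γ x) (Set.Ioi 0)) ∧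
    Tendsto (fun γ : ℝ => ProxComp.proxComp L g γ x) atTop
      (𝓝 (ProxComp.infPostcomp (ContinuousLinearMap.adjoint L) (ProxComp.biconj g) x)) ∧
    Tendsto (fun γ : ℝ => ProxComp.proxCocomp L g γ x) (𝓝[>] 0)
      (𝓝 (ProxComp.biconj g (L x))) ∧
    (‖L‖ < 1 →
      Tendsto (fun γ : ℝ => ProxComp.proxCocomp L g γ x) atTop
        (𝓝 (⨅ y : G, ProxComp.biconj g y))) ∧
    (‖L‖ = 1 →
      ∀ V : Set G,
        V = Set.range (ContinuousLinearMap.id ℝ G - L ∘L ContinuousLinearMap.adjoint L) →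
        IsClosed V →
        Tendsto (fun γ : ℝ => ProxComp.proxCocomp L g γ x) atTop
          (𝓝 (⨅ y ∈ (fun v : G => L x - v) '' V, ProxComp.biconj g y))) := by
  have hg1 : ∃ y, g y < ⊤ := hg.1
  have hg2 : ∃ u, ProxComp.conj g u < ⊤ := ProxComp.exists_conj_lt_top hcam
  refine ⟨⟨fun γ _ => ProxComp.proxComp_ne_bot hg2 γ x, ProxComp.proxComp_antitoneOn hL1 hg2 x⟩,
    ⟨fun γ hγ => ProxComp.proxCocomp_ne_bot hg1 hg2 hγ x, ProxComp.proxCocomp_antitoneOn hL1 hg1 x⟩,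
    ProxComp.tendsto_atTop_of_antitoneOn_Ioi (ProxComp.proxComp_antitoneOn hL1 hg2 x)
      (ProxComp.isGLB_proxComp hL1 hg2 x),
    ProxComp.tendsto_nhdsGT_of_antitoneOn_Ioi (ProxComp.proxCocomp_antitoneOn hL1 hg1 x)
      (ProxComp.isLUB_proxCocomp hL1 hg1 x), fun hL => ?_, ?_⟩
  · have hr := ProxComp.range_defect_eq_univ hL
    have h := ProxComp.tendsto_atTop_of_antitoneOn_Ioi (ProxComp.proxCocomp_antitoneOn hL1 hg1 x)
      (ProxComp.isGLB_proxCocomp hL1 hg1 hg2 (hr ▸ isClosed_univ) x)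
    have hs : (fun v : G => L x - v) '' Set.univ = Set.univ :=
      Set.image_univ_of_surjective fun y => ⟨L x - y, sub_sub_cancel _ _⟩
    simpa only [hr, hs, Set.mem_univ, iInf_pos] using h
  · rintro - V rfl hV
    exact ProxComp.tendsto_atTop_of_antitoneOn_Ioi (ProxComp.proxCocomp_antitoneOn hL1 hg1 x)
      (ProxComp.isGLB_proxCocomp hL1 hg1 hg2 hV x)
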